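/- For a positive integer $N$ let $V_N=\{0,\dots,N-1\}$, and let $\mathscr G_N$ be the set of simple graphs on $V_N$ containing all ground edges $\{x,x+1\}$. For $g\in\mathscr G_N$ with graph distance $\mathrm d_g$ and $p\in[1,\infty]$ let $$\mathcal H_p(g)=\Big(\frac1{N^2}\sum_{x,y\in V_N}\mathrm d_g(x,y)^p\Big)^{1/p}\quad(p<\infty),\qquad \mathcal H_\infty(g)=\max_{x,y\in V_N}\mathrm d_g(x,y).$$ Let $\mathbb P_1$ be the law on $\mathscr G_N$ of the random graph $\mathcal G_N$ containing all ground edges and in which the edges $e=\{x,y\}$ of length $|e|=|x-y|>1$ are present independently, each with probability $e^{-|e|}$. For $b\in\mathbb R$ let $\mathbb P^{b,p}_1$ be the Gibbs measure $$\mathbb P^{b,p}_1[\mathcal G_N=g]=\frac{\exp(-N^b\,\mathcal H_p(g))\,\mathbb P_1[\mathcal G_N=g]}{\mathbb E_1[\exp(-N^b\,\mathcal H_p(\mathcal G_N))]}.$$ For integers $k\ge1$ set $h(k,p)=\max\Big\{\frac{2p-(p-1)k}{k(k+1)(k+2p)},0\Big\}$ if $p<\infty$, $h(1,\infty)=\frac14$,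 and $h(k,\infty)=0$ if $k>1$. **Theorem.** Let $p\in[1,\infty]$. (1) If $k\ge1$ is an integer, $b\in\mathbb R$ satisfies $\frac{k-1}{k}+h(k,p)<b<\frac{k}{k+1}$, and $\varepsilon>0$, then $$\lim_{N\to\infty}\mathbb P^{b,p}_1\left[\left|\frac{\log\mathcal H_p(\mathcal G_N)}{\log N}-\frac1{k+1}\right|>\varepsilon\right]=0.$$ (2) If $p>1$, there are infinitely many discontinuous phase transitions as $b$ increases to $1$: there is an integer $K\ge1$ such that for every integer $k\ge K$ the limit in $\mathbb P^{b,p}_1$-probability of $\log\mathcal H_p(\mathcal G_N)/\log N$ as $N\to\infty$ equals $\frac1{k+1}$ for every $b\in\big(\frac{k-1}k,\frac k{k+1}\big)$ and equals $\frac1{k+2}$ for every $b\in\big(\frac k{k+1},\frac{k+1}{k+2}\big)$; that is, it jumps at $b=\frac{k}{k+1}$. -/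

import Mathlib

open MeasureTheory ProbabilityTheory Filter Topology
open scoped ENNReal

noncomputable section

/-- The set of simple graphs on the vertex set `{0, …, N-1}` containing every ground edge
`{x, x+1}` (the edges of the path graph). -/
def SpatialGraph (N : ℕ) : Type :=
  {G : SimpleGraph (Fin N) // SimpleGraph.pathGraph N ≤ G}

/-- All events on the finite set of graphs are measurable. -/
instance (N : ℕ) : MeasurableSpace (SpatialGraph N) := ⊤

/-- The possible edges `{x, y}` of length `|y - x| > 1`, each listed once, as the ordered
pair `(x, y)` with `x + 1 < y`. -/
def LongPair (N : ℕ) : Type :=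
  {e : Fin N × Fin N // (e.1 : ℕ) + 1 < (e.2 : ℕ)}

instance (N : ℕ) : Fintype (LongPair N) :=
  inferInstanceAs (Fintype {e : Fin N × Fin N // (e.1 : ℕ) + 1 < (e.2 : ℕ)})

/-- The Euclidean length `|e| = |y - x|` of a long edge. -/
def LongPair.length {N : ℕ} (e : LongPair N) : ℝ :=
  (e.1.2 : ℝ) - (e.1.1 : ℝ)

theorem LongPair.length_nonneg {N : ℕ} (e : LongPair N) : 0 ≤ e.length := by
  have h : (e.1.1 : ℕ) ≤ (e.1.2 : ℕ) := by have := e.2; omega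
  have h2 : ((e.1.1 : ℕ) : ℝ) ≤ ((e.1.2 : ℕ) : ℝ) := by exact_mod_cast h
  exact sub_nonneg.mpr h2

/-- The probability `exp (-|e|^γ)` of the presence of the long edge `e` under the reference
measure. -/
def edgeProb (γ : ℝ) {N : ℕ} (e : LongPair N) : unitInterval :=
  ⟨Real.exp (-(e.length ^ γ)), (Real.exp_pos _).le,
    Real.exp_le_one_iff.mpr (neg_nonpos.mpr (Real.rpow_nonneg e.length_nonneg γ))⟩

/-- The graph made of all ground edges and of the long edges selected by `ω`. -/
def graphOf {N : ℕ} (ω : LongPair N → Bool) : SpatialGraph N :=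
  ⟨SimpleGraph.pathGraph N ⊔
      SimpleGraph.fromEdgeSet {s | ∃ e : LongPair N, ω e = true ∧ s = s(e.1.1, e.1.2)},
    le_sup_left⟩

/-- The reference measure: long edges are present independently, the long edge `e` with
probability `exp (-|e|^γ)`. -/
def refMeasure (γ : ℝ) (N : ℕ) : Measure (SpatialGraph N) :=
  (Measure.pi fun e : LongPair N => bernoulliMeasure true false (edgeProb γ e)).map graphOf

/-- The `ℓ^p`-average path length `H_p(g) = (N⁻² ∑_{x,y} d_g(x,y)^p)^{1/p}` for `p < ∞`, and the
maximal graph distance for `p = ∞`. -/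
def avgPathLength (p : ℝ≥0∞) {N : ℕ} (g : SpatialGraph N) : ℝ :=
  if p = ⊤ then ⨆ q : Fin N × Fin N, (g.1.dist q.1 q.2 : ℝ)
  else (1 / (N : ℝ) ^ 2 * ∑ x : Fin N, ∑ y : Fin N, (g.1.dist x y : ℝ) ^ p.toReal)
    ^ (1 / p.toReal)

/-- The Gibbs measure, with density `exp (-N^b H_p(g)) / Z` with respect to the reference measure,
where `Z` is the reference expectation of `exp (-N^b H_p)`. -/
def gibbsMeasure (γ b : ℝ) (p : ℝ≥0∞) (N : ℕ) : Measure (SpatialGraph N) :=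
  (refMeasure γ N).tilted fun g => -((N : ℝ) ^ b * avgPathLength p g)

/-- Under the Gibbs measures, `log H_p / log N` converges in probability to `a` as `N → ∞`. -/
def HasPathExponent (γ b : ℝ) (p : ℝ≥0∞) (a : ℝ) : Prop :=
  ∀ ε : ℝ, 0 < ε → Tendsto
    (fun N : ℕ => gibbsMeasure γ b p N
      {g | ε < |Real.log (avgPathLength p g) / Real.log (N : ℝ) - a|})
    atTop (𝓝 0)

/-- The explicit gap function `h(k, p)`. -/
def hGap (k : ℕ) (p : ℝ≥0∞) : ℝ :=
  if p = ⊤ then (if k = 1 then 1 / 4 else 0)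
  else max ((2 * p.toReal - (p.toReal - 1) * (k : ℝ)) /
    ((k : ℝ) * ((k : ℝ) + 1) * ((k : ℝ) + 2 * p.toReal))) 0

end

/-! Write H for the path length. Entropy comes in multiples of N. A hierarchical graph with k levels
of shortcuts, of lengths L, L², …, L^k with L ≈ N^(1/(k+1)), has diameter O(L) and total shortcut
length at most kN, hence probability at least exp(-kN) (`exp_le_refMeasure`). Conversely, if H ≤ N^α
with kα < 1, then all but O(N^(1-t)) cuts of the ground path are crossed by at least k edges of
length at least N^t, where t is `sparseExponent`. These edges have total length kN - O(N^(1-t)) or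
more, and a Chernoff bound gives probability at most exp(-kN + O(N^(1-t) log N))
(`refMeasure_sum_dist_le`). The combinatorial core is `card_le_of_escapesIn`.

The hierarchical graphs bound the partition function below by exp(-kN - O(N^(b+1/(k+1)))). Against
this, H below N^(1/(k+1)) by a power costs an extra N of entropy, which wins because b < k/(k+1).
For H above N^(1-b) by a power, the energy alone exceeds order N. In between, the entropy gain
N^(1-t) log N loses to the energy N^(b+α) as soon as 1 - t < b + α. This condition is affine in α,
so it is tested at α = 1/(k+1), which produces h(k,p), and at α = 1 - b, which produces b > (k-1)/k.
-/

/-! ### Escaping from intervals and crossing cuts -/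

/-- From `x`, a path of at most `r` edges of `F` leads out of the integer interval `[u, v)`. -/
inductive EscapesIn (F : Finset (ℕ × ℕ)) (u v : ℕ) : ℕ → ℕ → Prop
  | out (r x : ℕ) : ¬ (u ≤ x ∧ x < v) → EscapesIn F u v r x
  | step (r x y : ℕ) : ((x, y) ∈ F ∨ (y, x) ∈ F) → EscapesIn F u v r y →
      EscapesIn F u v (r + 1) x

/-- Escaping persists in a subinterval, after deletion of an edge having both ends outside it. -/
theorem EscapesIn.erase {F : Finset (ℕ × ℕ)} {u v u' v' r x : ℕ} (h : EscapesIn F u v r x)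
    (hu : u ≤ u') (hv : v' ≤ v) (e : ℕ × ℕ) (h1 : e.1 < u') (h2 : v' ≤ e.2) :
    EscapesIn (F.erase e) u' v' r x := by
  induction h with
  | out r x hx => exact .out r x (by omega)
  | step r x y hxy _ ih =>
    -- Inside the subinterval, the edge used has an end there, so it is not `e`.
    by_cases hx : u' ≤ x ∧ x < v'
    · refine .step r x y ?_ ih
      rcases hxy with hxy | hxy
      · left
        refine Finset.mem_erase.2 ⟨?_, hxy⟩
        rintro rfl
        simp only at h1
        omega
      · right
        refine Finset.mem_erase.2 ⟨?_, hxy⟩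
        rintro rfl
        simp only at h2
        omega
    · exact .out _ _ hx

/-- The cut between `i` and `i + 1` is crossed by the edge `e`. -/
def CrossesCut (e : ℕ × ℕ) (i : ℕ) : Prop := e.1 ≤ i ∧ i < e.2

instance (e : ℕ × ℕ) (i : ℕ) : Decidable (CrossesCut e i) :=
  inferInstanceAs (Decidable (_ ∧ _))

/-- A short escape crosses either all the cuts on the left, or all the cuts on the right. -/
theorem EscapesIn.crosses {F : Finset (ℕ × ℕ)} (hF : ∀ e ∈ F, e.1 < e.2) {u v r x : ℕ}
    (h : EscapesIn F u v r x) :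
    (∃ P ⊆ F, P.card ≤ r ∧ ∀ i, u ≤ i → i < x → ∃ e ∈ P, CrossesCut e i) ∨
    (∃ P ⊆ F, P.card ≤ r ∧ ∀ i, x ≤ i → i < v → ∃ e ∈ P, CrossesCut e i) := by
  induction h with
  | out r x hx =>
    by_cases h : x < u
    · exact .inl ⟨∅, by simp, by simp, fun i _ _ => by omega⟩
    · exact .inr ⟨∅, by simp, by simp, fun i _ _ => by omega⟩
  | step r x y hxy _ ih =>
    -- The first edge crosses every cut between `x` and `y`; adding it to the edges that serve `y`
    -- serves `x`.
    obtain ⟨e, he, hc⟩ : ∃ e ∈ F, ∀ i, (x ≤ i ∧ i < y ∨ y ≤ i ∧ i < x) → CrossesCut e i := by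
      rcases hxy with hxy | hxy
      · have := hF _ hxy
        exact ⟨_, hxy, fun i hi => by simp only [CrossesCut] at *; omega⟩
      · have := hF _ hxy
        exact ⟨_, hxy, fun i hi => by simp only [CrossesCut] at *; omega⟩
    rcases ih with ⟨P, hP, hc1, hP1⟩ | ⟨P, hP, hc1, hP1⟩
    · refine .inl ⟨insert e P, Finset.insert_subset he hP,
        (Finset.card_insert_le _ _).trans (by omega), fun i h1 h2 => ?_⟩
      by_cases hi : i < y
      · obtain ⟨f, hf, hfc⟩ := hP1 i h1 hi
        exact ⟨f, Finset.mem_insert_of_mem hf, hfc⟩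
      · exact ⟨e, Finset.mem_insert_self _ _, hc i (by omega)⟩
    · refine .inr ⟨insert e P, Finset.insert_subset he hP,
        (Finset.card_insert_le _ _).trans (by omega), fun i h1 h2 => ?_⟩
      by_cases hi : y ≤ i
      · obtain ⟨f, hf, hfc⟩ := hP1 i hi h2
        exact ⟨f, Finset.mem_insert_of_mem hf, hfc⟩
      · exact ⟨e, Finset.mem_insert_self _ _, hc i (by omega)⟩

/-- If all vertices of `A` escape quickly, then few edges cross all cuts of `A` but one. -/
theorem exists_crossing_edges {F : Finset (ℕ × ℕ)} (hF : ∀ e ∈ F, e.1 < e.2) {u v R : ℕ}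
    (A : Finset ℕ) (hA : ∀ x ∈ A, u ≤ x ∧ x < v) (hesc : ∀ x ∈ A, EscapesIn F u v R x) :
    ∃ P ⊆ F, P.card ≤ 2 * R ∧ ∃ c, ∀ i ∈ A, i ≠ c → ∃ e ∈ P, CrossesCut e i := by
  classical
  set lft : ℕ → Prop := fun x =>
    ∃ P ⊆ F, P.card ≤ R ∧ ∀ i, u ≤ i → i < x → ∃ e ∈ P, CrossesCut e i with hl
  -- The least element of `A` beyond `m` can only escape to the right, and its path crosses all
  -- later cuts. With `m` the largest left-escaping element, whose own path crosses the earlier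
  -- cuts, only the cut `m` is missed.
  have key : ∀ m, (∀ x ∈ A, m < x → ¬ lft x) → ∃ P ⊆ F, P.card ≤ R ∧ ∀ i ∈ A, m < i →
      ∃ e ∈ P, CrossesCut e i := by
    intro m hm
    rcases (A.filter (m < ·)).eq_empty_or_nonempty with h | h
    · refine ⟨∅, by simp, by simp, fun i hi him => ?_⟩
      have : i ∈ A.filter (m < ·) := Finset.mem_filter.2 ⟨hi, him⟩
      simp [h] at this
    · have hmin := Finset.min'_mem _ h
      rw [Finset.mem_filter] at hmin
      rcases (hesc _ hmin.1).crosses hF with h1 | ⟨P, hP, hc, hP1⟩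
      · exact absurd h1 (hm _ hmin.1 hmin.2)
      · exact ⟨P, hP, hc, fun i hi him => hP1 i (Finset.min'_le _ _ (Finset.mem_filter.2 ⟨hi, him⟩))
          (hA i hi).2⟩
  rcases (A.filter lft).eq_empty_or_nonempty with h | h
  -- Nothing escapes to the left: 0 serves as the exceptional cut.
  · obtain ⟨P, hP, hc, h1⟩ := key 0 fun x hx _ hx' => by
      have : x ∈ A.filter lft := Finset.mem_filter.2 ⟨hx, hx'⟩
      simp [h] at this
    exact ⟨P, hP, by omega, 0, fun i hi hi0 => h1 i hi (Nat.pos_of_ne_zero hi0)⟩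
  · have hmax := Finset.max'_mem _ h
    rw [Finset.mem_filter] at hmax
    obtain ⟨P, hP, hc, h1⟩ := key ((A.filter lft).max' h) fun x hx hlt hx' =>
      absurd (Finset.le_max' _ x (Finset.mem_filter.2 ⟨hx, hx'⟩)) (by omega)
    obtain ⟨Q, hQ, hcQ, h2⟩ := hmax.2
    refine ⟨P ∪ Q, Finset.union_subset hP hQ, (Finset.card_union_le _ _).trans (by omega),
      (A.filter lft).max' h, fun i hi hne => ?_⟩
    rcases lt_or_gt_of_ne hne with hlt | hlt
    · obtain ⟨e, he, hei⟩ := h2 i (hA i hi).1 hlt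
      exact ⟨e, Finset.mem_union_right _ he, hei⟩
    · obtain ⟨e, he, hei⟩ := h1 i hi hlt
      exact ⟨e, Finset.mem_union_left _ he, hei⟩

/-- The edges of `F` of length at least `l` crossing the cut `i`. -/
def longCrossings (F : Finset (ℕ × ℕ)) (l i : ℕ) : Finset (ℕ × ℕ) :=
  F.filter fun e => e.1 + l ≤ e.2 ∧ CrossesCut e i

/-- If all vertices of `A` escape an interval in at most `R` steps, then few cuts of `A` are
crossed by less than `k` edges of length at least `l`. -/
theorem card_le_of_escapesIn {R l : ℕ} (hR : 1 ≤ R) (hl : 1 ≤ l) (k : ℕ) :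
    ∀ (F : Finset (ℕ × ℕ)) (_ : ∀ e ∈ F, e.1 < e.2) (u v : ℕ) (A : Finset ℕ)
      (_ : ∀ x ∈ A, u ≤ x ∧ x < v) (_ : ∀ x ∈ A, EscapesIn F u v R x)
      (_ : ∀ x ∈ A, (longCrossings F l x).card < k),
      A.card ≤ 7 ^ k * R ^ k * l := by
  induction k with
  | zero =>
    intro F hF u v A hA hesc hc
    have : A = ∅ := Finset.eq_empty_of_forall_notMem fun x hx => by simpa using hc x hx
    simp [this]
  | succ k ih =>
    intro F hF u v A hA hesc hc
    obtain ⟨P, hP, hPc, c, hcov⟩ := exists_crossing_edges hF A hA hesc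
    have hsub : A ⊆ insert c (P.biUnion fun e => A.filter (CrossesCut e)) := by
      intro i hi
      by_cases hic : i = c
      · simp [hic]
      · obtain ⟨e, he, hei⟩ := hcov i hi hic
        exact Finset.mem_insert_of_mem (Finset.mem_biUnion.2 ⟨e, he, Finset.mem_filter.2 ⟨hi, hei⟩⟩)
    have hedge : ∀ e ∈ P, (A.filter (CrossesCut e)).card ≤ l + 1 + 7 ^ k * R ^ k * l := by
      intro e he
      -- A short edge crosses fewer than `l` cuts; under a long one the induction applies, with the
      -- cut `e.1` set apart.
      by_cases hlen : e.1 + l ≤ e.2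
      · have hsub' : A.filter (CrossesCut e) ⊆
            insert e.1 (A.filter fun i => e.1 + 1 ≤ i ∧ i < e.2) := by
          intro i hi
          simp only [Finset.mem_filter, CrossesCut, Finset.mem_insert] at hi ⊢
          by_cases h : i = e.1
          · exact .inl h
          · exact .inr ⟨hi.1, by omega, hi.2.2⟩
        -- Erasing `e` lowers every count under it by one. Its ends lie outside `[e.1 + 1, e.2)`, so
        -- escaping from there does not need it.
        have := ih (F.erase e) (fun f hf => hF f (Finset.mem_of_mem_erase hf))
          (max u (e.1 + 1)) (min v e.2) (A.filter fun i => e.1 + 1 ≤ i ∧ i < e.2)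
          (fun x hx => by
            rw [Finset.mem_filter] at hx
            have := hA x hx.1
            omega)
          (fun x hx => (hesc x (Finset.mem_of_mem_filter x hx)).erase (le_max_left _ _)
            (min_le_left _ _) e (by omega) (by omega))
          (fun x hx => by
            rw [Finset.mem_filter] at hx
            have h1 := hc x hx.1
            have h2 : e ∈ longCrossings F l x := by
              rw [longCrossings, Finset.mem_filter]
              exact ⟨hP he, hlen, by omega, hx.2.2⟩
            have h3 : longCrossings (F.erase e) l x = (longCrossings F l x).erase e := by
              ext f
              simp only [longCrossings, Finset.mem_filter, Finset.mem_erase]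
              tauto
            rw [h3, Finset.card_erase_of_mem h2]
            have := Finset.card_pos.2 ⟨e, h2⟩
            omega)
        have h4 := (Finset.card_le_card hsub').trans (Finset.card_insert_le _ _)
        omega
      · have : A.filter (CrossesCut e) ⊆ Finset.Ico e.1 e.2 := fun i hi => by
          simp only [Finset.mem_filter, CrossesCut] at hi
          exact Finset.mem_Ico.2 hi.2
        have := Finset.card_le_card this
        rw [Nat.card_Ico] at this
        omega
    have h1 : A.card ≤ 2 * R * (l + 1 + 7 ^ k * R ^ k * l) + 1 := by
      refine (Finset.card_le_card hsub).trans ((Finset.card_insert_le _ _).trans ?_)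
      gcongr
      refine (Finset.card_biUnion_le_card_mul _ _ _ hedge).trans ?_
      gcongr
    have hpos : 1 ≤ 7 ^ k * R ^ k := Nat.one_le_iff_ne_zero.2 (by positivity)
    -- The four terms on the left contribute 2 + 2 + 2 + 1 = 7.
    have h2 : 2 * R * (l + 1 + 7 ^ k * R ^ k * l) + 1 ≤ 7 * R * (7 ^ k * R ^ k) * l := by
      set q := 7 ^ k * R ^ k
      have a1 : R * l ≤ R * l * q := Nat.le_mul_of_pos_right _ hpos
      have a2 : R ≤ R * l := Nat.le_mul_of_pos_right _ hl
      nlinarith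
    calc A.card ≤ _ := h1
      _ ≤ _ := h2
      _ = 7 ^ (k + 1) * R ^ (k + 1) * l := by ring

/-! ### From graph distances to sparse cuts -/

theorem SpatialGraph.reachable {N : ℕ} (g : SpatialGraph N) (x y : Fin N) : g.1.Reachable x y :=
  (SimpleGraph.pathGraph_preconnected N x y).mono g.2

/-- The edges of a graph, as pairs of natural numbers listed in increasing order. -/
noncomputable def orderedEdges {N : ℕ} (G : SimpleGraph (Fin N)) : Finset (ℕ × ℕ) := by
  classical
  exact (Finset.univ.filter fun p : Fin N × Fin N => G.Adj p.1 p.2 ∧ p.1 < p.2).image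
    fun p => ((p.1 : ℕ), (p.2 : ℕ))

theorem mem_orderedEdges {N : ℕ} {G : SimpleGraph (Fin N)} {e : ℕ × ℕ} :
    e ∈ orderedEdges G ↔
      ∃ x y : Fin N, G.Adj x y ∧ x < y ∧ e = ((x : ℕ), (y : ℕ)) := by
  classical
  simp only [orderedEdges, Finset.mem_image, Finset.mem_filter, Finset.mem_univ, true_and,
    Prod.exists]
  constructor
  · rintro ⟨x, y, ⟨h1, h2⟩, h3⟩
    exact ⟨x, y, h1, h2, h3.symm⟩
  · rintro ⟨x, y, h1, h2, h3⟩
    exact ⟨x, y, ⟨h1, h2⟩, h3.symm⟩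

theorem lt_of_mem_orderedEdges {N : ℕ} {G : SimpleGraph (Fin N)} {e : ℕ × ℕ}
    (h : e ∈ orderedEdges G) : e.1 < e.2 := by
  obtain ⟨x, y, -, hxy, rfl⟩ := mem_orderedEdges.1 h
  exact hxy

theorem escapesIn_of_walk {N : ℕ} {G : SimpleGraph (Fin N)} {u v : ℕ} {x z : Fin N}
    (w : G.Walk x z) (hz : ¬ (u ≤ (z : ℕ) ∧ (z : ℕ) < v)) :
    ∀ R, w.length ≤ R → EscapesIn (orderedEdges G) u v R x := by
  induction w with
  | nil => exact fun R _ => .out _ _ hz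
  | @cons x y z h w ih =>
    intro R hR
    rw [SimpleGraph.Walk.length_cons] at hR
    obtain ⟨R, rfl⟩ : ∃ R', R = R' + 1 := ⟨R - 1, by omega⟩
    refine .step R x y ?_ (ih hz R (by omega))
    rcases lt_or_gt_of_ne h.ne with h1 | h1
    · exact .inl (mem_orderedEdges.2 ⟨x, y, h, h1, rfl⟩)
    · exact .inr (mem_orderedEdges.2 ⟨y, x, h.symm, h1, rfl⟩)

theorem SpatialGraph.escapesIn {N : ℕ} (g : SpatialGraph N) {u v R : ℕ} {x z : Fin N}
    (hz : ¬ (u ≤ (z : ℕ) ∧ (z : ℕ) < v)) (h : g.1.dist x z ≤ R) :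
    EscapesIn (orderedEdges g.1) u v R x := by
  obtain ⟨w, hw⟩ := (g.reachable x z).exists_walk_length_eq_dist
  exact escapesIn_of_walk w hz R (hw.trans_le h)

/-- The cuts of the ground path crossed by less than `k` edges of length at least `l`. -/
noncomputable def sparseCuts {N : ℕ} (g : SpatialGraph N) (k l : ℕ) : Finset ℕ :=
  (Finset.range (N - 1)).filter fun i => (longCrossings (orderedEdges g.1) l i).card < k

-- The vertex `z` splits the path into two intervals, and a vertex within distance `R` of `z`
-- escapes from its own interval in `R` steps. Hence `card_le_of_escapesIn` applies on each side,
-- which gives the factor 2; the final 1 is for `z`.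
open Classical in
theorem card_sparseCuts_le {N : ℕ} (g : SpatialGraph N) {R l : ℕ} (hR : 1 ≤ R) (hl : 1 ≤ l)
    (k : ℕ) (z : Fin N) :
    (sparseCuts g k l).card ≤
      (Finset.univ.filter fun x : Fin N => R < g.1.dist x z).card + 2 * (7 ^ k * R ^ k * l) + 1 := by
  set bad : Finset ℕ := (Finset.univ.filter fun x : Fin N => R < g.1.dist x z).image
    (fun x : Fin N => (x : ℕ)) with hbad
  have main : ∀ u v : ℕ, v ≤ N → ¬ (u ≤ (z : ℕ) ∧ (z : ℕ) < v) →
      ((sparseCuts g k l).filter fun i => (u ≤ i ∧ i < v) ∧ i ∉ bad).card ≤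
        7 ^ k * R ^ k * l := by
    intro u v hv hz
    refine card_le_of_escapesIn hR hl k (orderedEdges g.1) (fun e => lt_of_mem_orderedEdges) u v _
      (fun x hx => (Finset.mem_filter.1 hx).2.1) (fun x hx => ?_)
      (fun x hx => (Finset.mem_filter.1 (Finset.mem_filter.1 hx).1).2)
    obtain ⟨-, hx1, hx2⟩ := Finset.mem_filter.1 hx
    have hxN : x < N := by omega
    refine SpatialGraph.escapesIn g (x := ⟨x, hxN⟩) hz ?_
    by_contra hcon
    refine hx2 (Finset.mem_image.2 ⟨⟨x, hxN⟩, Finset.mem_filter.2 ⟨Finset.mem_univ _, ?_⟩, rfl⟩)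
    exact not_le.1 hcon
  have h1 := main 0 z z.2.le (by omega)
  have h2 := main (z + 1) N le_rfl (by omega)
  have h3 : sparseCuts g k l ⊆ insert (z : ℕ) (bad ∪
      (((sparseCuts g k l).filter fun i => (0 ≤ i ∧ i < (z : ℕ)) ∧ i ∉ bad) ∪
        (sparseCuts g k l).filter fun i => ((z : ℕ) + 1 ≤ i ∧ i < N) ∧ i ∉ bad)) := by
    intro i hi
    have : i < N - 1 := Finset.mem_range.1 (Finset.mem_filter.1 hi).1
    by_cases hb : i ∈ bad
    · simp [hb]
    · simp only [Finset.mem_insert, Finset.mem_union, Finset.mem_filter, hi, hb]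
      simp only [not_false_eq_true, true_and, and_true]
      omega
  have h4 : bad.card ≤ (Finset.univ.filter fun x : Fin N => R < g.1.dist x z).card :=
    Finset.card_image_le
  have h5 := (Finset.card_le_card h3).trans (Finset.card_insert_le _ _)
  have h6 := Finset.card_union_le bad
      (((sparseCuts g k l).filter fun i => (0 ≤ i ∧ i < (z : ℕ)) ∧ i ∉ bad) ∪
        (sparseCuts g k l).filter fun i => ((z : ℕ) + 1 ≤ i ∧ i < N) ∧ i ∉ bad)
  have h7 := Finset.card_union_le
      ((sparseCuts g k l).filter fun i => (0 ≤ i ∧ i < (z : ℕ)) ∧ i ∉ bad)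
      ((sparseCuts g k l).filter fun i => ((z : ℕ) + 1 ≤ i ∧ i < N) ∧ i ∉ bad)
  omega

/-! ### Total length of the long edges -/

/-- The length of a long edge, as a natural number. -/
def LongPair.natLength {N : ℕ} (e : LongPair N) : ℕ := (e.1.2 : ℕ) - (e.1.1 : ℕ)

theorem LongPair.natLength_cast {N : ℕ} (e : LongPair N) : (e.natLength : ℝ) = e.length := by
  have := e.2
  rw [natLength, length, Nat.cast_sub (by omega)]

/-- The long edges selected by `ω` of length at least `l`. -/
def selectedEdges {N : ℕ} (ω : LongPair N → Bool) (l : ℕ) : Finset (LongPair N) :=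
  Finset.univ.filter fun e => ω e = true ∧ l ≤ e.natLength

theorem graphOf_adj_of_lt {N : ℕ} {ω : LongPair N → Bool} {x y : Fin N}
    (h : (graphOf ω).1.Adj x y) (hxy : (x : ℕ) + 1 < y) : ω ⟨(x, y), hxy⟩ = true := by
  rcases h with h | h
  · rw [SimpleGraph.pathGraph_adj] at h
    omega
  · rw [SimpleGraph.fromEdgeSet_adj] at h
    obtain ⟨⟨e, he, hs⟩, -⟩ := h
    have := e.2
    rw [Sym2.eq_iff] at hs
    rcases hs with ⟨h1, h2⟩ | ⟨h1, h2⟩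
    · subst h1 h2
      exact he
    · rw [h1, h2] at hxy
      omega

/-- Ground edges have length 1, so `2 ≤ l` leaves only selected edges. -/
theorem card_longCrossings_le {N : ℕ} (ω : LongPair N → Bool) {l : ℕ} (hl : 2 ≤ l) (i : ℕ) :
    (longCrossings (orderedEdges (graphOf ω).1) l i).card ≤
      ((selectedEdges ω l).filter fun e => CrossesCut (e.1.1, e.1.2) i).card := by
  classical
  refine (Finset.card_le_card (t := ((selectedEdges ω l).filter
    fun e => CrossesCut (e.1.1, e.1.2) i).image fun e => ((e.1.1 : ℕ), (e.1.2 : ℕ))) ?_).trans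
    Finset.card_image_le
  intro e he
  rw [longCrossings, Finset.mem_filter, mem_orderedEdges] at he
  obtain ⟨⟨x, y, hadj, hxy, rfl⟩, hlen, hcr⟩ := he
  simp only at hlen
  refine Finset.mem_image.2 ⟨⟨(x, y), by simp only; omega⟩, ?_, rfl⟩
  refine Finset.mem_filter.2 ⟨Finset.mem_filter.2 ⟨Finset.mem_univ _, ?_, ?_⟩, hcr⟩
  · exact graphOf_adj_of_lt hadj (by omega)
  · simp only [LongPair.natLength]
    omega

theorem LongPair.natLength_eq_card {N : ℕ} (e : LongPair N) :
    e.natLength = ((Finset.range (N - 1)).filter fun i => CrossesCut (e.1.1, e.1.2) i).card := by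
  have : ((Finset.range (N - 1)).filter fun i => CrossesCut (e.1.1, e.1.2) i) =
      Finset.Ico (e.1.1 : ℕ) e.1.2 := by
    ext i
    have := e.1.2.2
    rw [Finset.mem_filter, Finset.mem_range, Finset.mem_Ico]
    exact ⟨fun h => h.2, fun h => ⟨by omega, h⟩⟩
  rw [this, Nat.card_Ico, natLength]

open Classical in
/-- If most vertices are close to `z`, the total length of the long edges is almost `k * N`. -/
theorem mul_le_sum_natLength {N : ℕ} (ω : LongPair N → Bool) {R l : ℕ} (hR : 1 ≤ R) (hl : 2 ≤ l)
    (k : ℕ) (z : Fin N) :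
    k * N ≤ ∑ e ∈ selectedEdges ω l, e.natLength +
      k * ((Finset.univ.filter fun x : Fin N => R < (graphOf ω).1.dist x z).card +
        2 * (7 ^ k * R ^ k * l) + 2) := by
  -- Double counting of pairs (edge, cut): a length is a number of crossed cuts.
  have h1 : ∑ e ∈ selectedEdges ω l, e.natLength = ∑ i ∈ Finset.range (N - 1),
      ((selectedEdges ω l).filter fun e => CrossesCut (e.1.1, e.1.2) i).card := by
    simp_rw [LongPair.natLength_eq_card, Finset.card_filter]
    exact Finset.sum_comm
  have h2 : k * ((Finset.range (N - 1)) \ sparseCuts (graphOf ω) k l).card ≤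
      ∑ e ∈ selectedEdges ω l, e.natLength := by
    rw [h1, mul_comm, ← smul_eq_mul]
    refine (Finset.card_nsmul_le_sum _ _ k fun i hi => ?_).trans
      (Finset.sum_le_sum_of_subset Finset.sdiff_subset)
    rw [Finset.mem_sdiff, sparseCuts, Finset.mem_filter] at hi
    exact le_trans (not_lt.1 fun h => hi.2 ⟨hi.1, h⟩) (card_longCrossings_le ω hl i)
  have h3 := card_sparseCuts_le (graphOf ω) hR (by omega : 1 ≤ l) k z
  have h4 := Finset.le_card_sdiff (sparseCuts (graphOf ω) k l) (Finset.range (N - 1))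
  rw [Finset.card_range] at h4
  have h5 := z.pos
  -- The 2 accounts for `z` and for having only `N - 1` cuts.
  calc k * N ≤ k * (((Finset.range (N - 1)) \ sparseCuts (graphOf ω) k l).card +
      ((Finset.univ.filter fun x : Fin N => R < (graphOf ω).1.dist x z).card +
        2 * (7 ^ k * R ^ k * l) + 2)) := Nat.mul_le_mul_left _ (by omega)
    _ ≤ _ := by rw [mul_add]; omega

/-! ### Probability of a large total length -/

/-- The law of the selection of long edges when each one is present with probability
`exp (-|e|)`. -/
noncomputable abbrev selectionMeasure (N : ℕ) : Measure (LongPair N → Bool) :=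
  Measure.pi fun e : LongPair N => bernoulliMeasure true false (edgeProb 1 e)

theorem selectionMeasure_forall_mem {N : ℕ} (M : Finset (LongPair N)) :
    (selectionMeasure N).real {ω | ∀ e ∈ M, ω e = true} = Real.exp (-∑ e ∈ M, e.length) := by
  have h : {ω : LongPair N → Bool | ∀ e ∈ M, ω e = true} =
      (M : Set (LongPair N)).pi fun _ => {true} := by
    ext ω
    simp [Set.mem_pi]
  rw [h, measureReal_def, Measure.pi_pi_finset, ENNReal.toReal_prod, ← Finset.sum_neg_distrib,
    Real.exp_sum]
  refine Finset.prod_congr rfl fun e _ => ?_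
  rw [← measureReal_def, bernoulliMeasure_real_apply_of_mem_of_notMem _ (by simp) (by simp) (by simp)]
  simp [edgeProb]

theorem card_longPair_le (N : ℕ) : Fintype.card (LongPair N) ≤ N ^ 2 := by
  classical
  refine (Fintype.card_subtype_le _).trans ?_
  simp [sq]

/-- A Chernoff-type bound for the total length of the selected edges of length at least `l`. -/
theorem selectionMeasure_le_sum_length {N : ℕ} (hN : 1 ≤ N) {l : ℕ} {θ : ℝ} (h0 : 0 ≤ θ)
    (h1 : θ ≤ 1) (hl : 2 * Real.log N ≤ (1 - θ) * l) (L : ℝ) :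
    (selectionMeasure N).real {ω | L ≤ ∑ e ∈ selectedEdges ω l, e.length} ≤
      Real.exp (1 - θ * L) := by
  classical
  set E : Finset (LongPair N) := Finset.univ.filter fun e => l ≤ e.natLength with hE
  have hsub : {ω : LongPair N → Bool | L ≤ ∑ e ∈ selectedEdges ω l, e.length} ⊆
      ⋃ M ∈ E.powerset.filter (fun M => L ≤ ∑ e ∈ M, e.length), {ω | ∀ e ∈ M, ω e = true} := by
    intro ω hω
    simp only [Set.mem_iUnion]
    refine ⟨selectedEdges ω l, Finset.mem_filter.2 ⟨Finset.mem_powerset.2 fun e he => ?_, hω⟩,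
      fun e he => ?_⟩
    · exact Finset.mem_filter.2 ⟨Finset.mem_univ _, (Finset.mem_filter.1 he).2.2⟩
    · exact (Finset.mem_filter.1 he).2.1
  have hN0 : (0 : ℝ) < N := by exact_mod_cast hN
  calc (selectionMeasure N).real {ω | L ≤ ∑ e ∈ selectedEdges ω l, e.length}
      ≤ _ := measureReal_mono hsub (measure_ne_top _ _)
    _ ≤ ∑ M ∈ E.powerset.filter (fun M => L ≤ ∑ e ∈ M, e.length),
          (selectionMeasure N).real {ω | ∀ e ∈ M, ω e = true} :=
        measureReal_biUnion_finset_le _ _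
    -- The weight is split as θ + (1 - θ): the first share uses the constraint, the second makes the
    -- sum over all `M` a product.
    _ ≤ ∑ M ∈ E.powerset.filter (fun M => L ≤ ∑ e ∈ M, e.length),
          Real.exp (-(θ * L)) * ∏ e ∈ M, Real.exp (-((1 - θ) * e.length)) := by
        refine Finset.sum_le_sum fun M hM => ?_
        rw [selectionMeasure_forall_mem, ← Real.exp_sum, ← Real.exp_add, Real.exp_le_exp,
          Finset.sum_neg_distrib, ← Finset.mul_sum]
        have := mul_le_mul_of_nonneg_left (Finset.mem_filter.1 hM).2 h0
        linarith
    _ ≤ ∑ M ∈ E.powerset,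
          Real.exp (-(θ * L)) * ∏ e ∈ M, Real.exp (-((1 - θ) * e.length)) :=
        Finset.sum_le_sum_of_subset_of_nonneg (Finset.filter_subset _ _) fun M _ _ => by positivity
    _ = Real.exp (-(θ * L)) * ∏ e ∈ E, (1 + Real.exp (-((1 - θ) * e.length))) := by
        rw [← Finset.mul_sum, Finset.prod_one_add]
    -- Each of the at most N² factors is at most 1 + N⁻², by the hypothesis on `l`.
    _ ≤ Real.exp (-(θ * L)) * ∏ _e ∈ E, Real.exp (((N : ℝ) ^ 2)⁻¹) := by
        gcongr with e he
        have h2 : (l : ℝ) ≤ e.length := by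
          rw [← e.natLength_cast]
          exact_mod_cast (Finset.mem_filter.1 he).2
        have h3 : Real.exp (-((1 - θ) * e.length)) ≤ ((N : ℝ) ^ 2)⁻¹ := by
          rw [← Real.exp_log (inv_pos.2 (pow_pos hN0 2)), Real.exp_le_exp, Real.log_inv,
            Real.log_pow]
          have := mul_le_mul_of_nonneg_left h2 (sub_nonneg.2 h1)
          push_cast
          linarith
        have := Real.add_one_le_exp (((N : ℝ) ^ 2)⁻¹)
        linarith
    _ ≤ Real.exp (-(θ * L)) * Real.exp 1 := by
        rw [Finset.prod_const, ← Real.exp_nat_mul]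
        gcongr
        have h4 : (E.card : ℝ) ≤ (N : ℝ) ^ 2 := by
          exact_mod_cast (Finset.card_le_univ E).trans (card_longPair_le N)
        rw [← div_eq_mul_inv]
        exact div_le_one_of_le₀ h4 (by positivity)
    _ = Real.exp (1 - θ * L) := by rw [← Real.exp_add]; ring_nf

/-! ### Entropic cost of a short average path length -/

/-- The deficiency exponent: a graph with average path length `N ^ α` has long edges of total
length at least `k * N - O(N ^ (1 - sparseExponent k q α))`. -/
noncomputable def sparseExponent (k : ℕ) (q α : ℝ) : ℝ := q * (1 - k * α) / (k + 2 * q)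

-- Pigeonhole selects a `z` whose sum of q-th powers of distances is at most average; Markov's
-- inequality does the rest.
open Classical in
theorem card_dist_gt_le {N : ℕ} (hN : 1 ≤ N) {q α ρ : ℝ} (hq : 0 < q)
    {ω : LongPair N → Bool}
    (h : ∑ x : Fin N, ∑ y : Fin N, ((graphOf ω).1.dist x y : ℝ) ^ q ≤
      (N : ℝ) ^ 2 * ((N : ℝ) ^ α) ^ q) :
    ∃ z : Fin N, ((Finset.univ.filter fun x : Fin N =>
      ⌊(N : ℝ) ^ ρ⌋₊ < (graphOf ω).1.dist x z).card : ℝ) ≤ (N : ℝ) ^ (1 + q * α - q * ρ) := by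
  have hN0 : (0 : ℝ) < N := by exact_mod_cast hN
  have : Nonempty (Fin N) := ⟨⟨0, hN⟩⟩
  obtain ⟨z, -, hz⟩ : ∃ z ∈ (Finset.univ : Finset (Fin N)),
      ∑ y : Fin N, ((graphOf ω).1.dist z y : ℝ) ^ q ≤ (N : ℝ) * ((N : ℝ) ^ α) ^ q := by
    refine Finset.exists_le_of_sum_le Finset.univ_nonempty (h.trans (le_of_eq ?_))
    simp
    ring
  refine ⟨z, ?_⟩
  set B := Finset.univ.filter fun x : Fin N => ⌊(N : ℝ) ^ ρ⌋₊ < (graphOf ω).1.dist x z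
  have h1 : (B.card : ℝ) * ((N : ℝ) ^ ρ) ^ q ≤ (N : ℝ) * ((N : ℝ) ^ α) ^ q := by
    calc (B.card : ℝ) * ((N : ℝ) ^ ρ) ^ q = ∑ _x ∈ B, ((N : ℝ) ^ ρ) ^ q := by simp
      _ ≤ ∑ x ∈ B, ((graphOf ω).1.dist z x : ℝ) ^ q := by
          refine Finset.sum_le_sum fun x hx => ?_
          have := (Finset.mem_filter.1 hx).2
          rw [Nat.floor_lt (by positivity), SimpleGraph.dist_comm] at this
          exact Real.rpow_le_rpow (by positivity) this.le hq.le
      _ ≤ ∑ x, ((graphOf ω).1.dist z x : ℝ) ^ q :=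
          Finset.sum_le_sum_of_subset_of_nonneg (Finset.subset_univ _) fun _ _ _ => by positivity
      _ ≤ _ := hz
  rw [Real.rpow_sub hN0, Real.rpow_add hN0, Real.rpow_one, le_div_iff₀ (by positivity),
    mul_comm q, mul_comm q, Real.rpow_mul hN0.le, Real.rpow_mul hN0.le]
  exact h1

theorem sub_le_sum_length {k : ℕ} (hk : 1 ≤ k) {q α : ℝ} (hq : 0 < q) (hα : 0 ≤ α)
    (hkα : k * α < 1) {N : ℕ} (hN : 2 ≤ N) {ω : LongPair N → Bool}
    (h : ∑ x : Fin N, ∑ y : Fin N, ((graphOf ω).1.dist x y : ℝ) ^ q ≤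
      (N : ℝ) ^ 2 * ((N : ℝ) ^ α) ^ q) :
    k * N - k * (3 + 4 * 7 ^ k) * (N : ℝ) ^ (1 - sparseExponent k q α) ≤
      ∑ e ∈ selectedEdges ω ⌈(N : ℝ) ^ sparseExponent k q α⌉₊, e.length := by
  classical
  have hk0 : (0 : ℝ) < k := by exact_mod_cast hk
  have hN1 : (1 : ℝ) < N := by exact_mod_cast hN
  have hN0 : (0 : ℝ) < N := by linarith
  set t := sparseExponent k q α with ht
  have htd : t * (k + 2 * q) = q * (1 - k * α) := by
    rw [ht, sparseExponent, div_mul_cancel₀ _ (by positivity)]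
  have ht0 : 0 < t := by
    rw [ht, sparseExponent]
    have : 0 < 1 - k * α := by linarith
    positivity
  have hkα0 : 0 ≤ k * α := by positivity
  have ht1 : 2 * t ≤ 1 := by nlinarith
  -- With R ≈ N^ρ and l ≈ N^t, this makes R^k l ≈ N^(1-t); the value of t makes the Markov exponent
  -- 1 + qα - qρ equal to 1 - t too.
  set ρ := (1 - 2 * t) / k with hρ
  have hρk : ρ * k = 1 - 2 * t := div_mul_cancel₀ _ hk0.ne'
  have hρ0 : 0 ≤ ρ := div_nonneg (by linarith) hk0.le
  obtain ⟨z, hz⟩ := card_dist_gt_le (ρ := ρ) (by omega : 1 ≤ N) hq h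
  have hexp : 1 + q * α - q * ρ = 1 - t := by
    have : (1 + q * α - q * ρ) * k = (1 - t) * k := by linear_combination htd - q * hρk
    exact mul_right_cancel₀ hk0.ne' this
  rw [hexp] at hz
  have hR : 1 ≤ ⌊(N : ℝ) ^ ρ⌋₊ := (Nat.one_le_floor_iff _).2 (Real.one_le_rpow hN1.le hρ0)
  have hl : 2 ≤ ⌈(N : ℝ) ^ t⌉₊ := by
    have : 1 < ⌈(N : ℝ) ^ t⌉₊ := Nat.lt_ceil.2 (by simpa using Real.one_lt_rpow hN1 ht0)
    omega
  have hmain := mul_le_sum_natLength ω hR hl k z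
  have hmain' : (k : ℝ) * N ≤ ∑ e ∈ selectedEdges ω ⌈(N : ℝ) ^ t⌉₊, e.length +
      k * ((Finset.univ.filter fun x : Fin N =>
          ⌊(N : ℝ) ^ ρ⌋₊ < (graphOf ω).1.dist x z).card +
        2 * (7 ^ k * (⌊(N : ℝ) ^ ρ⌋₊ : ℝ) ^ k * ⌈(N : ℝ) ^ t⌉₊) + 2) := by
    simp_rw [← LongPair.natLength_cast]
    exact_mod_cast hmain
  have h1 : (1 : ℝ) ≤ (N : ℝ) ^ t := Real.one_le_rpow hN1.le ht0.le
  have h2 : (1 : ℝ) ≤ (N : ℝ) ^ (1 - t) := Real.one_le_rpow hN1.le (by linarith)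
  have h3 : (⌈(N : ℝ) ^ t⌉₊ : ℝ) ≤ 2 * (N : ℝ) ^ t := by
    have := Nat.ceil_lt_add_one (by positivity : 0 ≤ (N : ℝ) ^ t)
    linarith
  have h4 : (⌊(N : ℝ) ^ ρ⌋₊ : ℝ) ^ k ≤ (N : ℝ) ^ (1 - 2 * t) := by
    rw [← hρk, Real.rpow_mul hN0.le, Real.rpow_natCast]
    gcongr
    exact Nat.floor_le (by positivity)
  have h5 : (⌊(N : ℝ) ^ ρ⌋₊ : ℝ) ^ k * ⌈(N : ℝ) ^ t⌉₊ ≤ 2 * (N : ℝ) ^ (1 - t) := by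
    calc (⌊(N : ℝ) ^ ρ⌋₊ : ℝ) ^ k * ⌈(N : ℝ) ^ t⌉₊
        ≤ (N : ℝ) ^ (1 - 2 * t) * (2 * (N : ℝ) ^ t) := by gcongr
      _ = 2 * (N : ℝ) ^ (1 - t) := by
        rw [mul_left_comm, ← Real.rpow_add hN0]
        ring_nf
  have h6 : 7 ^ k * (⌊(N : ℝ) ^ ρ⌋₊ : ℝ) ^ k * ⌈(N : ℝ) ^ t⌉₊ ≤
      7 ^ k * (2 * (N : ℝ) ^ (1 - t)) := by
    rw [mul_assoc]
    gcongr
  -- Far vertices, sparse cuts and the additive 2 contribute 1, 4 · 7^k and 2.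
  have h7 := mul_le_mul_of_nonneg_left (add_le_add (add_le_add hz
    (mul_le_mul_of_nonneg_left h6 (by norm_num : (0 : ℝ) ≤ 2)))
    (by linarith : (2 : ℝ) ≤ 2 * (N : ℝ) ^ (1 - t))) hk0.le
  linarith

theorem measurableSet_spatialGraph {N : ℕ} (A : Set (SpatialGraph N)) : MeasurableSet A :=
  MeasurableSpace.measurableSet_top

theorem refMeasure_real {N : ℕ} (A : Set (SpatialGraph N)) :
    (refMeasure 1 N).real A = (selectionMeasure N).real (graphOf ⁻¹' A) := by
  rw [measureReal_def, refMeasure,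
    Measure.map_apply (measurable_of_finite _) (measurableSet_spatialGraph A),
    ← measureReal_def]

instance (N : ℕ) : IsProbabilityMeasure (refMeasure 1 N) :=
  Measure.isProbabilityMeasure_map (measurable_of_finite _).aemeasurable

/-- The reference probability of a small `ℓ^q`-average path length. -/
theorem refMeasure_sum_dist_le {k : ℕ} (hk : 1 ≤ k) {q α : ℝ} (hq : 0 < q) (hα : 0 ≤ α)
    (hkα : k * α < 1) :
    ∃ C : ℝ, ∀ᶠ N : ℕ in atTop, (refMeasure 1 N).real {g | ∑ x : Fin N, ∑ y : Fin N,
        (g.1.dist x y : ℝ) ^ q ≤ (N : ℝ) ^ 2 * ((N : ℝ) ^ α) ^ q} ≤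
      Real.exp (-(k * N) + C * ((N : ℝ) ^ (1 - sparseExponent k q α) * Real.log N)) := by
  set t := sparseExponent k q α with ht
  have ht0 : 0 < t := by
    rw [ht, sparseExponent]
    have : 0 < 1 - k * α := by linarith
    have : (0 : ℝ) < k := by exact_mod_cast hk
    positivity
  have hsmall : ∀ᶠ N : ℕ in atTop, 2 * Real.log N ≤ (N : ℝ) ^ t := by
    have := ((isLittleO_log_rpow_atTop ht0).bound (by norm_num : (0 : ℝ) < 1 / 2)).and
      (eventually_ge_atTop 1)
    filter_upwards [tendsto_natCast_atTop_atTop.eventually this] with N hN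
    rw [Real.norm_of_nonneg (Real.log_nonneg hN.2), Real.norm_of_nonneg (by positivity)] at hN
    linarith
  have ht1 : t ≤ 1 := by
    have h1 : (0 : ℝ) < k := by exact_mod_cast hk
    have h2 : 0 ≤ k * α := by positivity
    rw [ht, sparseExponent, div_le_one (by positivity)]
    nlinarith
  refine ⟨1 + k * (3 + 4 * 7 ^ k) + 2 * k, ?_⟩
  filter_upwards [hsmall, eventually_ge_atTop 3] with N hNt hN3
  have hN1 : (1 : ℝ) < N := by exact_mod_cast (by omega : 1 < N)
  have hN0 : (0 : ℝ) < N := by linarith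
  have hlog : 1 ≤ Real.log N := by
    rw [Real.le_log_iff_exp_le hN0]
    have : (3 : ℝ) ≤ N := by exact_mod_cast hN3
    linarith [Real.exp_one_lt_d9]
  have hp : 0 < (N : ℝ) ^ t := by positivity
  have hD : (1 : ℝ) ≤ (N : ℝ) ^ (1 - t) := Real.one_le_rpow hN1.le (by linarith)
  set C := (k : ℝ) * (3 + 4 * 7 ^ k) with hC
  set L := k * N - C * (N : ℝ) ^ (1 - t) with hL
  -- Up to rounding of the cutoff, the largest admissible θ; the loss (1 - θ)kN is 2k N^(1-t) log N,
  -- of the order of the deficiency up to the logarithm.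
  set θ := 1 - 2 * Real.log N / (N : ℝ) ^ t with hθ
  have hC0 : 0 ≤ C := by positivity
  rw [refMeasure_real]
  have hsub : graphOf ⁻¹' {g : SpatialGraph N | ∑ x : Fin N, ∑ y : Fin N,
      (g.1.dist x y : ℝ) ^ q ≤ (N : ℝ) ^ 2 * ((N : ℝ) ^ α) ^ q} ⊆
      {ω | L ≤ ∑ e ∈ selectedEdges ω ⌈(N : ℝ) ^ t⌉₊, e.length} := fun ω hω =>
    sub_le_sum_length hk hq hα hkα (by omega) hω
  have hfrac : 2 * Real.log N / (N : ℝ) ^ t ≤ 1 := (div_le_one hp).2 hNt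
  have hfrac0 : 0 ≤ 2 * Real.log N / (N : ℝ) ^ t := by positivity
  refine (measureReal_mono hsub).trans ((selectionMeasure_le_sum_length (by omega) (θ := θ)
    (by linarith) (by linarith) ?_ L).trans (Real.exp_le_exp.2 ?_))
  · calc 2 * Real.log N = (1 - θ) * (N : ℝ) ^ t := by rw [hθ]; field_simp; ring
      _ ≤ (1 - θ) * ⌈(N : ℝ) ^ t⌉₊ := by
        gcongr
        · linarith
        · exact Nat.le_ceil _
  · have h1 : L ≤ k * N := by rw [hL]; nlinarith
    have h2 : 2 * Real.log N / (N : ℝ) ^ t * L ≤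
        2 * k * ((N : ℝ) ^ (1 - t) * Real.log N) := by
      refine (mul_le_mul_of_nonneg_left h1 hfrac0).trans (le_of_eq ?_)
      rw [Real.rpow_sub hN0, Real.rpow_one]
      field_simp
    have h3 : (N : ℝ) ^ (1 - t) ≤ (N : ℝ) ^ (1 - t) * Real.log N :=
      le_mul_of_one_le_right (by positivity) hlog
    have h4 := mul_le_mul_of_nonneg_left h3 hC0
    have h5 : θ * L = L - 2 * Real.log N / (N : ℝ) ^ t * L := by rw [hθ]; ring
    rw [h5]
    linarith

/-! ### Comparing path-length averages -/

theorem SpatialGraph.connected {N : ℕ} (g : SpatialGraph N) (z : Fin N) : g.1.Connected :=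
  haveI : Nonempty (Fin N) := ⟨z⟩
  ⟨g.reachable⟩

theorem avgPathLength_le {p : ℝ≥0∞} (hp : 1 ≤ p) {N : ℕ} (hN : 1 ≤ N) (g : SpatialGraph N) {T : ℝ}
    (hT : ∀ x y, (g.1.dist x y : ℝ) ≤ T) : avgPathLength p g ≤ T := by
  have : Nonempty (Fin N) := ⟨⟨0, hN⟩⟩
  have hN0 : (0 : ℝ) < N := by exact_mod_cast hN
  rw [avgPathLength]
  split_ifs with h
  · exact ciSup_le fun q => hT q.1 q.2
  · have hp0 : 0 < p.toReal := ENNReal.toReal_pos (by positivity) h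
    have hT0 : 0 ≤ T := (Nat.cast_nonneg _).trans (hT ⟨0, hN⟩ ⟨0, hN⟩)
    rw [one_div p.toReal, Real.rpow_inv_le_iff_of_pos (by positivity) hT0 hp0, one_div,
      inv_mul_le_iff₀ (by positivity)]
    calc ∑ x : Fin N, ∑ y : Fin N, (g.1.dist x y : ℝ) ^ p.toReal
        ≤ ∑ x : Fin N, ∑ y : Fin N, T ^ p.toReal := by
          gcongr
          exact hT _ _
      _ = (N : ℝ) ^ 2 * T ^ p.toReal := by simp; ring

/-- The maximum dominates every power mean, so for p = ∞ the exponent q stays free; it is later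
taken large. -/
theorem sum_dist_rpow_le {p : ℝ≥0∞} {q : ℝ} (hq : 0 < q) (hpq : p = ⊤ ∨ p.toReal = q) {N : ℕ}
    (hN : 1 ≤ N) (g : SpatialGraph N) {T : ℝ} (hT0 : 0 ≤ T) (hT : avgPathLength p g ≤ T) :
    ∑ x : Fin N, ∑ y : Fin N, (g.1.dist x y : ℝ) ^ q ≤ (N : ℝ) ^ 2 * T ^ q := by
  have hN0 : (0 : ℝ) < N := by exact_mod_cast hN
  rw [avgPathLength] at hT
  split_ifs at hT with h
  · calc ∑ x : Fin N, ∑ y : Fin N, (g.1.dist x y : ℝ) ^ q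
        ≤ ∑ x : Fin N, ∑ y : Fin N, T ^ q := by
          gcongr with x _ y
          exact (le_ciSup (f := fun q : Fin N × Fin N => (g.1.dist q.1 q.2 : ℝ))
            (Set.finite_range _).bddAbove (x, y)).trans hT
      _ = (N : ℝ) ^ 2 * T ^ q := by simp; ring
  · obtain rfl := hpq.resolve_left h
    rwa [one_div p.toReal, Real.rpow_inv_le_iff_of_pos (by positivity) hT0 hq, one_div,
      inv_mul_le_iff₀ (by positivity)] at hT

theorem avgPathLength_pos {p : ℝ≥0∞} {N : ℕ} (hN : 2 ≤ N) (g : SpatialGraph N) :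
    0 < avgPathLength p g := by
  have hN0 : (0 : ℝ) < N := by exact_mod_cast (by omega : 0 < N)
  set x : Fin N := ⟨0, by omega⟩
  set y : Fin N := ⟨1, by omega⟩
  have hd : 0 < (g.1.dist x y : ℝ) := by
    exact_mod_cast (g.connected x).pos_dist_of_ne (by simp [x, y])
  rw [avgPathLength]
  split_ifs with h
  · exact hd.trans_le (le_ciSup (f := fun q : Fin N × Fin N => (g.1.dist q.1 q.2 : ℝ))
            (Set.finite_range _).bddAbove (x, y))
  · have : 0 < ∑ x : Fin N, ∑ y : Fin N, (g.1.dist x y : ℝ) ^ p.toReal := by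
      refine Finset.sum_pos' (fun _ _ => Finset.sum_nonneg fun _ _ => by positivity)
        ⟨x, Finset.mem_univ _, Finset.sum_pos' (fun _ _ => by positivity)
          ⟨y, Finset.mem_univ _, by positivity⟩⟩
    positivity

/-! ### Hierarchical graphs -/

instance (N : ℕ) : DecidableEq (LongPair N) :=
  inferInstanceAs (DecidableEq {e : Fin N × Fin N // (e.1 : ℕ) + 1 < (e.2 : ℕ)})

/-- The edges joining consecutive multiples of `m`. -/
def levelEdges (N m : ℕ) : Finset (LongPair N) :=
  Finset.univ.filter fun e => (e.1.2 : ℕ) = e.1.1 + m ∧ m ∣ e.1.1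

/-- The edges of a hierarchical graph with `k` levels, of respective lengths `L, L ^ 2, …`. -/
def hierarchicalEdges (N k L : ℕ) : Finset (LongPair N) :=
  (Finset.Icc 1 k).biUnion fun j => levelEdges N (L ^ j)

theorem sum_length_levelEdges_le {N m : ℕ} (hm : 0 < m) :
    ∑ e ∈ levelEdges N m, e.length ≤ N := by
  have h1 : (levelEdges N m).card ≤ N / m := by
    rw [← Finset.card_range (N / m)]
    refine Finset.card_le_card_of_injOn (fun e => (e.1.1 : ℕ) / m) (fun e he => ?_) ?_
    · obtain ⟨-, h1, h2⟩ := Finset.mem_filter.1 he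
      have := e.1.2.2
      rw [Finset.coe_range, Set.mem_Iio, Nat.lt_iff_add_one_le, Nat.le_div_iff_mul_le hm, add_mul,
        Nat.div_mul_cancel h2]
      omega
    · intro e he f hf hef
      obtain ⟨-, h1, h2⟩ := Finset.mem_filter.1 he
      obtain ⟨-, h3, h4⟩ := Finset.mem_filter.1 hf
      have h5 : (e.1.1 : ℕ) = f.1.1 := by
        rw [← Nat.div_mul_cancel h2, ← Nat.div_mul_cancel h4]
        simp only at hef
        rw [hef]
      exact Subtype.ext (Prod.ext (Fin.ext h5) (Fin.ext (by omega)))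
  have h2 : ∀ e ∈ levelEdges N m, e.length = m := fun e he => by
    obtain ⟨-, h1, -⟩ := Finset.mem_filter.1 he
    rw [LongPair.length, h1]
    push_cast
    ring
  rw [Finset.sum_congr rfl h2, Finset.sum_const, nsmul_eq_mul]
  exact_mod_cast (Nat.mul_le_mul_right m h1).trans (Nat.div_mul_le_self N m)

theorem sum_length_hierarchicalEdges_le {N k L : ℕ} (hL : 0 < L) :
    ∑ e ∈ hierarchicalEdges N k L, e.length ≤ k * N := by
  have h : ∀ s : Finset ℕ, ∑ e ∈ s.biUnion (fun j => levelEdges N (L ^ j)), e.length ≤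
      s.card * N := by
    intro s
    induction s using Finset.induction_on with
    | empty => simp
    | insert a s ha ih =>
      rw [Finset.biUnion_insert, Finset.card_insert_of_notMem ha]
      have h1 := sum_length_levelEdges_le (N := N) (pow_pos hL a)
      have h2 := Finset.sum_union_inter (s₁ := levelEdges N (L ^ a))
        (s₂ := s.biUnion (fun j => levelEdges N (L ^ j))) (f := LongPair.length)
      have h3 : 0 ≤ ∑ e ∈ levelEdges N (L ^ a) ∩ s.biUnion (fun j => levelEdges N (L ^ j)),
        e.length := Finset.sum_nonneg fun e _ => e.length_nonneg
      push_cast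
      linarith
  simpa [hierarchicalEdges] using h (Finset.Icc 1 k)

section Hierarchical

variable {N k L : ℕ} {ω : LongPair N → Bool}

theorem graphOf_adj_of_hierarchicalEdges (hL : 2 ≤ L)
    (hω : ∀ e ∈ hierarchicalEdges N k L, ω e = true) {j : ℕ} (hj : j ≤ k) {x y : Fin N}
    (hxy : (y : ℕ) = x + L ^ j) (hx : L ^ j ∣ x) : (graphOf ω).1.Adj x y := by
  rcases Nat.eq_zero_or_pos j with rfl | hj0
  · refine (graphOf ω).2 ?_
    rw [SimpleGraph.pathGraph_adj]
    left
    simpa using hxy.symm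
  · have h2 : 1 < L ^ j := Nat.one_lt_pow hj0.ne' (by omega)
    have hlt : (x : ℕ) + 1 < y := by omega
    refine Or.inr ((SimpleGraph.fromEdgeSet_adj _).2 ⟨⟨⟨(x, y), hlt⟩, hω _ ?_, rfl⟩, ?_⟩)
    · exact Finset.mem_biUnion.2 ⟨j, Finset.mem_Icc.2 ⟨hj0, hj⟩,
        Finset.mem_filter.2 ⟨Finset.mem_univ _, hxy, hx⟩⟩
    · rintro rfl
      omega

theorem dist_mul_add_le (hL : 2 ≤ L) (hω : ∀ e ∈ hierarchicalEdges N k L, ω e = true) {j : ℕ}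
    (hj : j ≤ k) (q m : ℕ) : ∀ x y : Fin N, (x : ℕ) = L ^ j * q → (y : ℕ) = L ^ j * (q + m) →
      (graphOf ω).1.dist x y ≤ m := by
  induction m with
  | zero =>
    intro x y hx hy
    have : x = y := Fin.ext (by rw [hx, hy, add_zero])
    simp [this]
  | succ m ih =>
    intro x y hx hy
    have hz : L ^ j * (q + m) < N := by
      refine lt_of_le_of_lt ?_ y.2
      rw [hy]
      gcongr
      omega
    have h1 := ih x ⟨_, hz⟩ hx rfl
    have h2 : (graphOf ω).1.Adj ⟨_, hz⟩ y :=
      graphOf_adj_of_hierarchicalEdges hL hω hj (by rw [hy]; simp only; ring) (dvd_mul_right _ _)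
    have h3 := ((graphOf ω).connected x).dist_triangle (u := x) (v := ⟨_, hz⟩) (w := y)
    rw [SimpleGraph.dist_eq_one_iff_adj.2 h2] at h3
    omega

/-- Base-`L` digits of `x` are cleared one at a time: clearing digit `j` takes fewer than `L` edges
of level `j`. Levels 0 to `k` clear `k + 1` digits. -/
theorem dist_mul_div_le (hL : 2 ≤ L) (hω : ∀ e ∈ hierarchicalEdges N k L, ω e = true)
    (x : Fin N) (j : ℕ) : j ≤ k + 1 → ∀ y : Fin N, (y : ℕ) = L ^ j * (x / L ^ j) →
      (graphOf ω).1.dist y x ≤ j * L := by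
  induction j with
  | zero =>
    intro _ y hy
    have : y = x := Fin.ext (by simpa using hy)
    simp [this]
  | succ j ih =>
    intro hj y hy
    have hz : L ^ j * (x / L ^ j) < N := (Nat.mul_div_le _ _).trans_lt x.2
    have h1 := ih (by omega) ⟨_, hz⟩ rfl
    have h2 := dist_mul_add_le hL hω (by omega : j ≤ k) (L * (x / L ^ j / L)) (x / L ^ j % L)
      y ⟨_, hz⟩ (by rw [hy, pow_succ, Nat.div_div_eq_div_mul, mul_assoc])
      (by rw [Nat.div_add_mod])
    have h3 := ((graphOf ω).connected x).dist_triangle (u := y) (v := ⟨_, hz⟩) (w := x)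
    have h4 := Nat.mod_lt ((x : ℕ) / L ^ j) (by omega : 0 < L)
    rw [add_mul]
    omega

theorem dist_le_of_hierarchicalEdges (hL : 2 ≤ L) (hN : N ≤ L ^ (k + 1))
    (hω : ∀ e ∈ hierarchicalEdges N k L, ω e = true) (x y : Fin N) :
    (graphOf ω).1.dist x y ≤ 2 * (k + 1) * L := by
  set z : Fin N := ⟨0, x.pos⟩ with hz
  have h : ∀ w : Fin N, (graphOf ω).1.dist z w ≤ (k + 1) * L := fun w =>
    dist_mul_div_le hL hω w (k + 1) le_rfl z (by
      rw [Nat.div_eq_of_lt (w.2.trans_le hN)]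
      simp [hz])
  have h1 := ((graphOf ω).connected x).dist_triangle (u := x) (v := z) (w := y)
  rw [SimpleGraph.dist_comm (u := x) (v := z)] at h1
  have := h x
  have := h y
  linarith

end Hierarchical

/-- The reference probability of an average path length of order `N ^ (1 / (k + 1))`. -/
theorem exp_le_refMeasure {p : ℝ≥0∞} (hp : 1 ≤ p) (k : ℕ) {N : ℕ} (hN : 2 ≤ N) :
    Real.exp (-(k * N)) ≤ (refMeasure 1 N).real
      {g | avgPathLength p g ≤ 4 * (k + 1) * (N : ℝ) ^ (1 / ((k : ℝ) + 1))} := by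
  have hN1 : (1 : ℝ) < N := by exact_mod_cast hN
  have hN0 : (0 : ℝ) < N := by linarith
  have hk : (0 : ℝ) < k + 1 := by positivity
  -- With this base `k + 1` digits suffice; the ceiling at most doubles it, whence 4(k + 1) from the
  -- diameter 2(k + 1)L.
  set L := ⌈(N : ℝ) ^ (1 / ((k : ℝ) + 1))⌉₊ with hL
  have h1 : 1 < (N : ℝ) ^ (1 / ((k : ℝ) + 1)) := Real.one_lt_rpow hN1 (by positivity)
  have hL2 : 2 ≤ L := by
    have : 1 < L := Nat.lt_ceil.2 (by simpa using h1)
    omega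
  have hLN : N ≤ L ^ (k + 1) := by
    have : (N : ℝ) ≤ (L : ℝ) ^ (k + 1) := by
      calc (N : ℝ) = ((N : ℝ) ^ (1 / ((k : ℝ) + 1))) ^ (k + 1) := by
            rw [← Real.rpow_natCast, ← Real.rpow_mul hN0.le]
            push_cast
            rw [one_div_mul_cancel hk.ne', Real.rpow_one]
        _ ≤ (L : ℝ) ^ (k + 1) := by
            gcongr
            exact Nat.le_ceil _
    exact_mod_cast this
  have hLle : (L : ℝ) ≤ 2 * (N : ℝ) ^ (1 / ((k : ℝ) + 1)) := by
    have := Nat.ceil_lt_add_one (by positivity : 0 ≤ (N : ℝ) ^ (1 / ((k : ℝ) + 1)))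
    linarith
  rw [refMeasure_real]
  refine le_trans ?_ (measureReal_mono (s₁ := {ω | ∀ e ∈ hierarchicalEdges N k L, ω e = true})
    fun ω hω => ?_)
  · rw [selectionMeasure_forall_mem, Real.exp_le_exp, neg_le_neg_iff]
    exact sum_length_hierarchicalEdges_le (by omega)
  · refine avgPathLength_le hp (by omega) _ fun x y => ?_
    calc ((graphOf ω).1.dist x y : ℝ) ≤ ((2 * (k + 1) * L : ℕ) : ℝ) := by
          exact_mod_cast dist_le_of_hierarchicalEdges hL2 hLN hω x y
      _ = 2 * (k + 1) * (L : ℝ) := by push_cast; ring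
      _ ≤ 2 * (k + 1) * (2 * (N : ℝ) ^ (1 / ((k : ℝ) + 1))) := by gcongr
      _ = _ := by ring

/-! ### Gibbs measure against reference measure -/

instance (N : ℕ) : DiscreteMeasurableSpace (SpatialGraph N) := ⟨measurableSet_spatialGraph⟩

instance (N : ℕ) : Finite (SpatialGraph N) :=
  inferInstanceAs (Finite {G : SimpleGraph (Fin N) // SimpleGraph.pathGraph N ≤ G})

/-- Comparison of the Gibbs measure with the reference measure. -/
theorem gibbsMeasure_le {p : ℝ≥0∞} (hp : 1 ≤ p) (k : ℕ) (b : ℝ) {N : ℕ} (hN : 2 ≤ N)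
    {A : Set (SpatialGraph N)} {h : ℝ} (hA : ∀ g ∈ A, h ≤ avgPathLength p g) :
    gibbsMeasure 1 b p N A ≤ ENNReal.ofReal (Real.exp (k * N +
      4 * (k + 1) * (N : ℝ) ^ (b + 1 / ((k : ℝ) + 1)) - (N : ℝ) ^ b * h) *
        (refMeasure 1 N).real A) := by
  have hN0 : (0 : ℝ) < N := by exact_mod_cast (by omega : 0 < N)
  set f : SpatialGraph N → ℝ := fun g => -((N : ℝ) ^ b * avgPathLength p g) with hf
  set Z := ∫ g, Real.exp (f g) ∂(refMeasure 1 N) with hZ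
  have hb : 0 ≤ (N : ℝ) ^ b := by positivity
  -- The partition function is restricted to graphs of path length O(N^(1/(k+1))).
  have hZlow : Real.exp (-(k * N + 4 * (k + 1) * (N : ℝ) ^ (b + 1 / ((k : ℝ) + 1)))) ≤ Z := by
    set S : Set (SpatialGraph N) :=
      {g | avgPathLength p g ≤ 4 * (k + 1) * (N : ℝ) ^ (1 / ((k : ℝ) + 1))} with hS
    calc Real.exp (-(k * N + 4 * (k + 1) * (N : ℝ) ^ (b + 1 / ((k : ℝ) + 1))))
        = Real.exp (-(4 * (k + 1) * (N : ℝ) ^ (b + 1 / ((k : ℝ) + 1)))) *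
            Real.exp (-(k * N)) := by
          rw [← Real.exp_add]
          ring_nf
      _ ≤ Real.exp (-(4 * (k + 1) * (N : ℝ) ^ (b + 1 / ((k : ℝ) + 1)))) *
            (refMeasure 1 N).real S := by
          gcongr
          exact exp_le_refMeasure hp k hN
      _ = ∫ g in S, Real.exp (-(4 * (k + 1) * (N : ℝ) ^ (b + 1 / ((k : ℝ) + 1))))
            ∂(refMeasure 1 N) := by
          rw [setIntegral_const, smul_eq_mul, mul_comm]
      _ ≤ ∫ g in S, Real.exp (f g) ∂(refMeasure 1 N) := by
          refine setIntegral_mono_on Integrable.of_finite Integrable.of_finite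
            (measurableSet_spatialGraph S) fun g hg => ?_
          rw [Real.exp_le_exp, hf, neg_le_neg_iff, Real.rpow_add hN0]
          calc _ ≤ (N : ℝ) ^ b * (4 * (k + 1) * (N : ℝ) ^ (1 / ((k : ℝ) + 1))) :=
                mul_le_mul_of_nonneg_left hg hb
            _ = _ := by ring
      _ ≤ Z := setIntegral_le_integral Integrable.of_finite
          (Eventually.of_forall fun g => (Real.exp_pos _).le)
  have hZ0 : 0 < Z := (Real.exp_pos _).trans_le hZlow
  rw [gibbsMeasure, tilted_apply_eq_ofReal_integral]
  refine ENNReal.ofReal_le_ofReal ?_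
  calc ∫ g in A, Real.exp (f g) / Z ∂(refMeasure 1 N)
      ≤ ∫ g in A, Real.exp (k * N +
          4 * (k + 1) * (N : ℝ) ^ (b + 1 / ((k : ℝ) + 1)) - (N : ℝ) ^ b * h)
            ∂(refMeasure 1 N) := by
        refine setIntegral_mono_on Integrable.of_finite Integrable.of_finite
          (measurableSet_spatialGraph A) fun g hg => ?_
        rw [div_le_iff₀ hZ0]
        refine le_trans ?_ (mul_le_mul_of_nonneg_left hZlow (Real.exp_pos _).le)
        rw [← Real.exp_add, Real.exp_le_exp, hf]
        have := mul_le_mul_of_nonneg_left (hA g hg) hb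
        simp only
        linarith
    _ = _ := by rw [setIntegral_const, smul_eq_mul, mul_comm]

/-- Common shape of the estimates below: a leading power beats an entropy error with a logarithm and
the energy kept in the partition function. -/
theorem tendsto_exp_neg_rpow {c d₁ d₂ : ℝ} (hc : 0 < c) (h₁ : d₁ < c) (h₂ : d₂ < c) (C₁ C₂ : ℝ) :
    Tendsto (fun N : ℕ => ENNReal.ofReal (Real.exp (-(N : ℝ) ^ c +
      C₁ * ((N : ℝ) ^ d₁ * Real.log N) + C₂ * (N : ℝ) ^ d₂))) atTop (𝓝 0) := by
  have e1 : (fun x : ℝ => C₁ * (x ^ d₁ * Real.log x)) =o[atTop] fun x => x ^ c := by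
    refine Asymptotics.IsLittleO.const_mul_left ?_ C₁
    refine ((Asymptotics.isBigO_refl (fun x : ℝ => x ^ d₁) atTop).mul_isLittleO
      (isLittleO_log_rpow_atTop (sub_pos.2 h₁))).congr' EventuallyEq.rfl ?_
    filter_upwards [eventually_gt_atTop 0] with x hx
    rw [← Real.rpow_add hx, add_sub_cancel]
  have e2 : (fun x : ℝ => C₂ * x ^ d₂) =o[atTop] fun x => x ^ c := by
    refine Asymptotics.IsLittleO.const_mul_left ?_ C₂
    have h : (fun _ : ℝ => (1 : ℝ)) =o[atTop] fun x : ℝ => x ^ (c - d₂) :=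
      (Asymptotics.isLittleO_one_left_iff ℝ).2
        (tendsto_norm_atTop_atTop.comp (tendsto_rpow_atTop (sub_pos.2 h₂)))
    refine ((Asymptotics.isBigO_refl (fun x : ℝ => x ^ d₂) atTop).mul_isLittleO h).congr'
      (Eventually.of_forall fun x => mul_one _) ?_
    filter_upwards [eventually_gt_atTop 0] with x hx
    rw [← Real.rpow_add hx, add_sub_cancel]
  have e3 : Tendsto (fun x : ℝ => -x ^ c + C₁ * (x ^ d₁ * Real.log x) + C₂ * x ^ d₂) atTop
      atBot := by
    refine tendsto_atBot_mono' (f₁ := fun x : ℝ => -((1 / 2) * x ^ c)) _ ?_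
      (tendsto_neg_atTop_atBot.comp ((tendsto_rpow_atTop hc).const_mul_atTop (by norm_num)))
    filter_upwards [(e1.add e2).bound (by norm_num : (0 : ℝ) < 1 / 2), eventually_gt_atTop 0]
      with x hx hx0
    rw [Real.norm_of_nonneg (by positivity : 0 ≤ x ^ c), Real.norm_eq_abs] at hx
    have := (abs_le.1 hx).2
    linarith
  have := ENNReal.tendsto_ofReal ((Real.tendsto_exp_atBot.comp e3).comp
    tendsto_natCast_atTop_atTop)
  simpa [Function.comp_def] using this

/-! ### Unlikely ranges of the path length -/

section Bands

variable {p : ℝ≥0∞} {q : ℝ} {k : ℕ} {b : ℝ}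

/-- Average path lengths in a window inside `(N ^ (1 / (k + 1)), N ^ (1 / k))` are unlikely. -/
theorem tendsto_gibbsMeasure_window (hp : 1 ≤ p) (hq : 0 < q) (hpq : p = ⊤ ∨ p.toReal = q)
    (hk : 1 ≤ k) {α β : ℝ} (hb : 0 < b + α) (hβ : 0 ≤ β) (hkβ : k * β < 1)
    (hα : 1 / ((k : ℝ) + 1) < α) (hgap : 1 - sparseExponent k q β < b + α) :
    Tendsto (fun N : ℕ => gibbsMeasure 1 b p N
      {g | (N : ℝ) ^ α ≤ avgPathLength p g ∧ avgPathLength p g ≤ (N : ℝ) ^ β}) atTop (𝓝 0) := by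
  obtain ⟨C, hC⟩ := refMeasure_sum_dist_le hk hq hβ hkβ
  refine tendsto_of_tendsto_of_tendsto_of_le_of_le' tendsto_const_nhds
    (tendsto_exp_neg_rpow hb hgap (add_lt_add_right hα b) C (4 * (k + 1)))
    (Eventually.of_forall fun _ => zero_le) ?_
  filter_upwards [hC, eventually_ge_atTop 2] with N hCN hN
  have hN0 : (0 : ℝ) < N := by exact_mod_cast (by omega : 0 < N)
  refine (gibbsMeasure_le hp k b hN (h := (N : ℝ) ^ α) fun g hg => hg.1).trans
    (ENNReal.ofReal_le_ofReal ?_)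
  refine (mul_le_mul_of_nonneg_left ((measureReal_mono fun g hg => ?_).trans hCN)
    (Real.exp_pos _).le).trans (le_of_eq ?_)
  · exact sum_dist_rpow_le hq hpq (by omega) g (by positivity) hg.2
  -- The kN from the partition function cancels the -kN of the entropy.
  · rw [← Real.exp_add, ← Real.rpow_add hN0]
    ring_nf

/-- Average path lengths much smaller than `N ^ (1 / (k + 1))` are unlikely. -/
theorem tendsto_gibbsMeasure_le (hp : 1 ≤ p) (hq : 0 < q) (hpq : p = ⊤ ∨ p.toReal = q)
    (hb : b + 1 / ((k : ℝ) + 1) < 1) {α : ℝ} (hα : 0 ≤ α) (hkα : ((k : ℝ) + 1) * α < 1) :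
    Tendsto (fun N : ℕ => gibbsMeasure 1 b p N {g | avgPathLength p g ≤ (N : ℝ) ^ α})
      atTop (𝓝 0) := by
  -- Entropy at level `k + 1` against a partition function at level `k`: a net -N remains, and the
  -- energy can be discarded.
  obtain ⟨C, hC⟩ := refMeasure_sum_dist_le (k := k + 1) (by omega) hq hα (by exact_mod_cast hkα)
  have hs : 0 < sparseExponent (k + 1) q α := by
    have : 0 < 1 - ((k + 1 : ℕ) : ℝ) * α := by push_cast; linarith
    rw [sparseExponent]
    positivity
  refine tendsto_of_tendsto_of_tendsto_of_le_of_le' tendsto_const_nhds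
    (tendsto_exp_neg_rpow one_pos (sub_lt_self 1 hs) hb C (4 * (k + 1)))
    (Eventually.of_forall fun _ => zero_le) ?_
  filter_upwards [hC, eventually_ge_atTop 2] with N hCN hN
  refine (gibbsMeasure_le hp k b hN (h := 0) fun g _ => (avgPathLength_pos hN g).le).trans
    (ENNReal.ofReal_le_ofReal ?_)
  refine (mul_le_mul_of_nonneg_left ((measureReal_mono fun g hg => ?_).trans hCN)
    (Real.exp_pos _).le).trans (le_of_eq ?_)
  · exact sum_dist_rpow_le hq hpq (by omega) g (by positivity) hg
  · rw [← Real.exp_add, Real.rpow_one]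
    push_cast
    ring_nf

/-- Average path lengths much larger than `N ^ (1 - b)` are unlikely. -/
theorem tendsto_gibbsMeasure_ge_of_one_lt (hp : 1 ≤ p) {α : ℝ} (hα : 1 < b + α)
    (hb : b + 1 / ((k : ℝ) + 1) < 1) :
    Tendsto (fun N : ℕ => gibbsMeasure 1 b p N {g | (N : ℝ) ^ α ≤ avgPathLength p g})
      atTop (𝓝 0) := by
  refine tendsto_of_tendsto_of_tendsto_of_le_of_le' tendsto_const_nhds
    (tendsto_exp_neg_rpow (by linarith) hα (hb.trans hα) k (4 * (k + 1)))
    (Eventually.of_forall fun _ => zero_le) ?_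
  filter_upwards [eventually_ge_atTop 3] with N hN
  have hN0 : (0 : ℝ) < N := by exact_mod_cast (by omega : 0 < N)
  have hlog : 1 ≤ Real.log N := by
    rw [Real.le_log_iff_exp_le hN0]
    have : (3 : ℝ) ≤ N := by exact_mod_cast hN
    linarith [Real.exp_one_lt_d9]
  refine (gibbsMeasure_le hp k b (by omega) (h := (N : ℝ) ^ α) fun g hg => hg).trans
    (ENNReal.ofReal_le_ofReal ?_)
  refine (mul_le_of_le_one_right (Real.exp_pos _).le measureReal_le_one).trans
    (Real.exp_le_exp.2 ?_)
  rw [← Real.rpow_add hN0, Real.rpow_one]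
  -- A superfluous logarithm fits kN into `tendsto_exp_neg_rpow`.
  have : (k : ℝ) * N ≤ k * (N * Real.log N) := by
    gcongr
    exact le_mul_of_one_le_right hN0.le hlog
  linarith

/-- Windows of width η in the exponent, at most `n` of them, lead from α beyond 1 - b, where the
energy alone suffices. -/
theorem tendsto_gibbsMeasure_ge (hp : 1 ≤ p) (hq : 0 < q) (hpq : p = ⊤ ∨ p.toReal = q)
    (hk : 1 ≤ k) (hb0 : 0 < b) (hb : b + 1 / ((k : ℝ) + 1) < 1) {η : ℝ} (hη : 0 < η)
    (hkη : k * (1 - b + η) < 1)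
    (hgap : ∀ α, 1 / ((k : ℝ) + 1) < α → α ≤ 1 - b → 1 - sparseExponent k q (α + η) < b + α)
    (n : ℕ) : ∀ α, 1 / ((k : ℝ) + 1) < α → 1 - b < α + n * η →
      Tendsto (fun N : ℕ => gibbsMeasure 1 b p N {g | (N : ℝ) ^ α ≤ avgPathLength p g})
        atTop (𝓝 0) := by
  induction n with
  | zero =>
    intro α _ hα
    exact tendsto_gibbsMeasure_ge_of_one_lt hp (by simp at hα; linarith) hb
  | succ n ih =>
    intro α hα1 hα
    rcases lt_or_ge (1 - b) α with h | h
    · exact tendsto_gibbsMeasure_ge_of_one_lt hp (by linarith) hb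
    have hk0 : (0 : ℝ) < k + 1 := by positivity
    have hα0 : 0 < α := lt_trans (by positivity) hα1
    have h1 := tendsto_gibbsMeasure_window hp hq hpq hk (α := α) (β := α + η) (b := b)
      (by linarith) (by linarith)
      (lt_of_le_of_lt (mul_le_mul_of_nonneg_left (by linarith) (by positivity)) hkη) hα1
      (hgap α hα1 h)
    have h2 := ih (α + η) (by linarith) (by push_cast at hα; linarith)
    refine tendsto_of_tendsto_of_tendsto_of_le_of_le tendsto_const_nhds
      (by simpa using h1.add h2) (fun _ => zero_le) fun N => ?_
    refine (measure_mono fun g hg => ?_).trans (measure_union_le _ _)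
    rcases le_total (avgPathLength p g) ((N : ℝ) ^ (α + η)) with h3 | h3
    · exact .inl ⟨hg, h3⟩
    · exact .inr h3

end Bands

/-! ### Choice of parameters and conclusion -/

theorem hasPathExponent_of_gap {p : ℝ≥0∞} {q : ℝ} {k : ℕ} {b : ℝ} (hp : 1 ≤ p) (hq : 0 < q)
    (hpq : p = ⊤ ∨ p.toReal = q) (hk : 1 ≤ k)
    (h1 : ((k : ℝ) - 1) / k + max ((2 * q - (q - 1) * k) / (k * (k + 1) * (k + 2 * q))) 0 < b)
    (h2 : b < (k : ℝ) / (k + 1)) : HasPathExponent 1 b p (1 / ((k : ℝ) + 1)) := by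
  have hk1 : (1 : ℝ) ≤ k := by exact_mod_cast hk
  have hk0 : (0 : ℝ) < k := by linarith
  have hb1 : ((k : ℝ) - 1) / k < b := 
    lt_of_le_of_lt (le_add_of_nonneg_right (le_max_right _ _)) h1
  have hb0 : 0 < b := lt_of_le_of_lt (div_nonneg (by linarith) hk0.le) hb1
  have hkb : k * (1 - b) < 1 := by
    rw [div_lt_iff₀ hk0] at hb1
    linarith
  have hbk : b + 1 / ((k : ℝ) + 1) < 1 := by
    have : (k : ℝ) / (k + 1) + 1 / (k + 1) = 1 := by field_simp
    linarith
  set a := 1 / ((k : ℝ) + 1) with ha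
  have ha0 : 0 < a := by positivity
  have hak : ((k : ℝ) + 1) * a = 1 := by rw [ha]; field_simp
  set κ := q * k / (k + 2 * q) with hκ
  have hκ0 : 0 < κ := by positivity
  set s := q / (k + 2 * q) with hs
  have hs0 : 0 < s := by positivity
  have hsp : ∀ α, sparseExponent k q α = s - κ * α := fun α => by
    rw [sparseExponent, hs, hκ]
    ring
  have hgapa : 1 - (s - κ * a) < b + a := by
    have h3 : ((k : ℝ) - 1) / k + (2 * q - (q - 1) * k) / (k * (k + 1) * (k + 2 * q)) < b :=
      lt_of_le_of_lt (by gcongr; exact le_max_left _ _) h1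
    -- The gap condition at α = 1/(k+1) is exactly the lower bound on b.
    have h4 : 1 - (s - κ * a) - a =
        ((k : ℝ) - 1) / k + (2 * q - (q - 1) * k) / (k * (k + 1) * (k + 2 * q)) := by
      rw [hs, hκ, ha]
      field_simp
      ring
    linarith
  have hgapb : 0 < s - κ * (1 - b) := by
    have : s - κ * (1 - b) = s * (1 - k * (1 - b)) := by rw [hs, hκ]; ring
    rw [this]
    exact mul_pos hs0 (by linarith)
  set γ := min (b + a - (1 - (s - κ * a))) (s - κ * (1 - b)) with hγ
  have hγ0 : 0 < γ := lt_min (by linarith) hgapb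
  have hγ1 : ∀ α, a ≤ α → α ≤ 1 - b → γ ≤ b + α - (1 - (s - κ * α)) := by
    intro α hα1 hα2
    have h3 : γ ≤ b + a - (1 - (s - κ * a)) := min_le_left _ _
    have h4 : γ ≤ s - κ * (1 - b) := min_le_right _ _
    -- The margin is affine in α with slope 1 - κ, so it is smallest at one of the two ends.
    rcases le_total κ 1 with h | h
    · nlinarith
    · nlinarith
  set η := min (γ / (2 * κ)) ((1 - k * (1 - b)) / (2 * k)) with hη
  have hη0 : 0 < η := lt_min (by positivity) (div_pos (by linarith) (by positivity))
  have hη1 : κ * η < γ := by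
    have : η ≤ γ / (2 * κ) := min_le_left _ _
    rw [le_div_iff₀ (by positivity)] at this
    linarith
  have hη2 : k * (1 - b + η) < 1 := by
    have : η ≤ (1 - k * (1 - b)) / (2 * k) := min_le_right _ _
    rw [le_div_iff₀ (by positivity)] at this
    linarith
  intro ε hε
  -- The cap at `a` keeps the exponent a - δ nonnegative.
  set δ := min ε a with hδ
  have hδ0 : 0 < δ := lt_min hε ha0
  have hδa : δ ≤ a := min_le_right _ _
  have hδε : δ ≤ ε := min_le_left _ _
  obtain ⟨n, hn⟩ := exists_nat_gt ((1 - b) / η)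
  rw [div_lt_iff₀ hη0] at hn
  have t1 := tendsto_gibbsMeasure_le hp hq hpq hbk (α := a - δ) (by linarith)
    ((mul_lt_mul_of_pos_left (sub_lt_self a hδ0) (by positivity)).trans_eq hak)
  have t2 := tendsto_gibbsMeasure_ge hp hq hpq hk hb0 hbk hη0 hη2 (fun α hα1 hα2 => by
    rw [hsp]
    have := hγ1 α hα1.le hα2
    linarith) n (a + δ) (by linarith) (by linarith)
  refine tendsto_of_tendsto_of_tendsto_of_le_of_le' tendsto_const_nhds
    (by simpa using t1.add t2) (Eventually.of_forall fun _ => zero_le) ?_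
  filter_upwards [eventually_ge_atTop 2] with N hN
  refine (measure_mono fun g hg => ?_).trans (measure_union_le _ _)
  have hN1 : (1 : ℝ) < N := by exact_mod_cast hN
  have hN0 : (0 : ℝ) < N := by linarith
  have hlog := Real.log_pos hN1
  have hH := avgPathLength_pos (p := p) hN g
  rcases lt_abs.1 (Set.mem_ofPred_eq ▸ hg) with h | h
  · right
    rw [Set.mem_ofPred_eq, ← Real.log_le_log_iff (by positivity) hH, Real.log_rpow hN0,
      ← le_div_iff₀ hlog]
    linarith
  · left
    rw [Set.mem_ofPred_eq, ← Real.log_le_log_iff hH (by positivity), Real.log_rpow hN0,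
      ← div_le_iff₀ hlog]
    linarith

theorem hasPathExponent_of_hGap {p : ℝ≥0∞} (hp : 1 ≤ p) {k : ℕ} {b : ℝ} (hk : 1 ≤ k)
    (h1 : ((k : ℝ) - 1) / k + hGap k p < b) (h2 : b < (k : ℝ) / (k + 1)) :
    HasPathExponent 1 b p (1 / ((k : ℝ) + 1)) := by
  by_cases h : p = ⊤
  · obtain ⟨q, hq, hqb⟩ : ∃ q : ℝ, 0 < q ∧
        ((k : ℝ) - 1) / k + max ((2 * q - (q - 1) * k) / (k * (k + 1) * (k + 2 * q))) 0 < b := by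
      rw [hGap, if_pos h] at h1
      rcases eq_or_lt_of_le hk with rfl | hk2
      · norm_num at h1
        have hb : 0 < 4 * b - 1 := by linarith
        -- For k = 1 the quotient is (q+1)/(2(1+2q)), which tends to 1/4 < b as q → ∞.
        refine ⟨1 + 1 / (4 * b - 1), by positivity, ?_⟩
        have h3 : (1 + 1 / (4 * b - 1)) * (4 * b - 1) = 4 * b := by field_simp; ring
        have h4 : 0 < 1 / (4 * b - 1) := by positivity
        set q := 1 + 1 / (4 * b - 1)
        norm_num
        refine ⟨?_, by linarith⟩
        rw [div_lt_iff₀ (by positivity)]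
        nlinarith
      · rw [if_neg (by omega), add_zero] at h1
        have hk2' : (2 : ℝ) ≤ k := by exact_mod_cast hk2
        have hb : 0 < b - ((k : ℝ) - 1) / k := by linarith
        set c := b - ((k : ℝ) - 1) / k with hc
        have h4 : 0 < 1 / c := by positivity
        have h5 : (1 + 1 / c) * c = c + 1 := by field_simp
        -- For k ≥ 2 and q ≥ 1 the numerator is at most 2, so 2qc > 2 is enough.
        refine ⟨1 + 1 / c, by positivity, ?_⟩
        set q := 1 + 1 / c with hq
        rw [← lt_sub_iff_add_lt', ← hc, max_lt_iff]
        refine ⟨?_, hb⟩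
        rw [div_lt_iff₀ (by positivity)]
        have h6 : 2 * q - (q - 1) * k ≤ 2 := by nlinarith
        have h7 : (1 : ℝ) ≤ k * (k + 1) := by nlinarith
        have h8 : 2 < c * (k + 2 * q) := by nlinarith
        have h9 : c * (k + 2 * q) ≤ c * (k * (k + 1) * (k + 2 * q)) := by
          gcongr
          exact le_mul_of_one_le_left (by positivity) h7
        linarith
    exact hasPathExponent_of_gap hp hq (.inl h) hk hqb h2
  · rw [hGap, if_neg h] at h1
    exact hasPathExponent_of_gap hp (ENNReal.toReal_pos (by positivity) h) (.inr rfl) hk h1 h2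

/-- For finite p > 1 the numerator is nonpositive once k ≥ 2p/(p-1); at p = 1 it is constantly 2. -/
theorem exists_hGap_eq_zero {p : ℝ≥0∞} (hp : 1 < p) :
    ∃ K : ℕ, 1 ≤ K ∧ ∀ k, K ≤ k → hGap k p = 0 := by
  by_cases h : p = ⊤
  · refine ⟨2, by norm_num, fun k hk => ?_⟩
    rw [hGap, if_pos h, if_neg (by omega)]
  · have hp1 : 1 < p.toReal := by
      rw [← ENNReal.toReal_one]
      exact (ENNReal.toReal_lt_toReal ENNReal.one_ne_top h).2 hp
    obtain ⟨K, hK⟩ := exists_nat_ge (2 * p.toReal / (p.toReal - 1))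
    refine ⟨K + 1, by omega, fun k hk => ?_⟩
    rw [hGap, if_neg h]
    refine max_eq_right (div_nonpos_of_nonpos_of_nonneg ?_ (by positivity))
    have h1 : (K : ℝ) ≤ k := by exact_mod_cast (by omega : K ≤ k)
    have h2 := (div_le_iff₀ (by linarith)).1 (hK.trans h1)
    linarith

theorem theorem2 (p : ℝ≥0∞) (hp : 1 ≤ p) :
    (∀ (k : ℕ) (b : ℝ), 1 ≤ k → ((k : ℝ) - 1) / (k : ℝ) + hGap k p < b →
      b < (k : ℝ) / ((k : ℝ) + 1) → HasPathExponent 1 b p (1 / ((k : ℝ) + 1))) ∧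
    (1 < p → ∃ K : ℕ, 1 ≤ K ∧ ∀ k : ℕ, K ≤ k →
      (∀ b : ℝ, ((k : ℝ) - 1) / (k : ℝ) < b → b < (k : ℝ) / ((k : ℝ) + 1) →
        HasPathExponent 1 b p (1 / ((k : ℝ) + 1))) ∧
      (∀ b : ℝ, (k : ℝ) / ((k : ℝ) + 1) < b → b < ((k : ℝ) + 1) / ((k : ℝ) + 2) →
        HasPathExponent 1 b p (1 / ((k : ℝ) + 2)))) := by
  refine ⟨fun k b hk h1 h2 => hasPathExponent_of_hGap hp hk h1 h2, fun hp1 => ?_⟩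
  obtain ⟨K, hK1, hK⟩ := exists_hGap_eq_zero hp1
  refine ⟨K, hK1, fun k hk => ⟨fun b h1 h2 => hasPathExponent_of_hGap hp (by omega)
    (by rwa [hK k hk, add_zero]) h2, fun b h1 h2 => ?_⟩⟩
  -- The second range of b is the first one for `k + 1`, where the gap vanishes as well.
  have e1 : ((k + 1 : ℕ) : ℝ) + 1 = (k : ℝ) + 2 := by push_cast; ring
  have e2 : ((k + 1 : ℕ) : ℝ) - 1 = (k : ℝ) := by push_cast; ring
  rw [← e1]
  refine hasPathExponent_of_hGap hp (by omega) ?_ ?_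
  · rw [hK _ (by omega), add_zero, e2]
    exact_mod_cast h1
  · rw [e1]
    exact_mod_cast h2
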